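/- Let $\mathfrak c = 2^{\aleph_0}$ and let $\mathfrak b$ be the bounding number, i.e. the least cardinality of a family $\mathcal F \subseteq {}^{\omega}\omega$ for which there is no $g \in {}^{\omega}\omega$ such that, for every $f \in \mathcal F$, $f(n) \le g(n)$ for all but finitely many $n$. A free ultrafilter $u$ on a countably infinite set $S$ is a P-point if for each partition $(V_n)_{n<\omega}$ of $S$ there is $U \in u$ such that either $U \subseteq V_n$ for some $n$, or $U \cap V_n$ is finite for all $n$. For ultrafilters $u, v$ write $v \le_{RK} u$ if there is a map $h$ with $h^{-1}(A) \in u$ for all $A \in v$. Let $X$ be the (countable) set of all functions $x : \mathbb Q \to \omega$ with $x(r) = 0$ for all but finitely many $r$, and for $\xi \in \mathbb R$ let $h_\xi : X \to X$ be given by $h_\xi(x)(r) = x(r)$ if $r < \xi$ and $h_\xi(x)(r) = 0$ if $r \ge \xi$. Theorem. Assume $\mathfrak b = \mathfrak c$. Then there is an order embedding of the real line into the set of P-points on $\omega$ preordered by $\le_{RK}$. More precisely, there is a P-point $D$ on $X$ such that, with $h_\xi(D) = \{A \subseteq X : h_\xi^{-1}(A) \in D\}$, every $h_\xi(D)$ ($\xi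 \in \mathbb R$) is a P-point on $X$ and, for all $\xi, \eta \in \mathbb R$, $\xi \le \eta$ if and only if $h_\xi(D) \le_{RK} h_\eta(D)$; and for some bijection $e : X \to \omega$ the map $\xi \mapsto e(h_\xi(D))$ is an order embedding, in the same sense, of $\mathbb R$ into the P-points on $\omega$. -/

import Mathlib

/-- The bounding number `𝔟`: the least cardinality of a family of functions `ℕ → ℕ` such that no
single function `g` satisfies `f n ≤ g n` for almost all `n`, for every `f` in the family. -/
noncomputable def boundingNumber : Cardinal.{0} :=
  sInf {κ : Cardinal.{0} | ∃ F : Set (ℕ → ℕ), Cardinal.mk F = κ ∧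
    ¬ ∃ g : ℕ → ℕ, ∀ f ∈ F, ∀ᶠ n in Filter.atTop, f n ≤ g n}

/-- A P-point (on a countable set): a free ultrafilter `u` such that for each partition `(V n)` into
countably many pieces there is `U ∈ u` that is contained in one piece or has finite intersection
with all of them. (Some `V n` may be empty, so finite partitions are included.) -/
def IsPPoint {α : Type} (u : Ultrafilter α) : Prop :=
  (u : Filter α) ≤ Filter.cofinite ∧
    ∀ V : ℕ → Set α, Pairwise (Function.onFun Disjoint V) → (⋃ n, V n) = Set.univ →
      ∃ U ∈ u, (∃ n, U ⊆ V n) ∨ ∀ n, (U ∩ V n).Finite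

/-- The Rudin-Keisler preorder on filters: `G ≤ F` if some map `h` satisfies `h⁻¹(G) ⊆ F`. -/
def RKLE {α β : Type} (G : Filter β) (F : Filter α) : Prop :=
  ∃ h : α → β, ∀ S ∈ G, h ⁻¹' S ∈ F

/-- The P-points on `α`. -/
structure PPoint (α : Type) where
  toUltrafilter : Ultrafilter α
  isPPoint : IsPPoint toUltrafilter

/-- The P-points on `α`, preordered by the Rudin-Keisler relation. -/
instance PPoint.instPreorder (α : Type) : Preorder (PPoint α) where
  le p q := RKLE (p.toUltrafilter : Filter α) (q.toUltrafilter : Filter α)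
  le_refl _ := ⟨id, fun _ hS => hS⟩
  le_trans := by
    rintro p q r ⟨h, hh⟩ ⟨k, hk⟩
    exact ⟨h ∘ k, fun S hS => hk _ (hh S hS)⟩

/-- The map `h_ξ` on finitely supported functions `ℚ → ℕ`: `h_ξ(x)(r) = x(r)` if `r < ξ`, and
`h_ξ(x)(r) = 0` if `ξ ≤ r`. -/
noncomputable def truncBelow (ξ : ℝ) (x : ℚ →₀ ℕ) : ℚ →₀ ℕ :=
  x.filter (fun r : ℚ => (r : ℝ) < ξ)

/-! Call a subset of X small if it splits into finitely many pieces, on each of which some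
coordinate x(p) is a function of the coordinates below p. Small sets form a proper ideal, since
finitely many predictions can be evaded (`exists_forall_apply_ne`). It is a countable union of
grades, each membership of which is decided by finite subsets. For such an ideal, 𝔟 = 𝔠 yields a
P-point D with no small member (`exists_isPPoint`): a recursion of length 𝔠 treats every function X
→ ω.

If η < ξ and g witnesses h_ξ(D) ≤ h_η(D), then g ∘ h_η maps h_ξ(D) to itself, so it is the identity
on a member (`Ultrafilter.eventually_eq_of_map_eq`). For rational p in (η, ξ), the coordinate at p
is then determined by those below η on a member of D, which is therefore small: a contradiction. -/

/-- Transfinite recursion for a relation: if values satisfying `R` below `i` can always be continued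
at `i`, then there is a function satisfying `R` everywhere. -/
theorem exists_forall_of_forall_exists_extension {ι β : Type*} [LinearOrder ι] [WellFoundedLT ι]
    [Nonempty β] (R : ι → (ι → β) → β → Prop)
    (hcongr : ∀ i f f' b, (∀ j < i, f j = f' j) → R i f b → R i f' b)
    (hext : ∀ i f, (∀ j < i, R j f (f j)) → ∃ b, R i f b) :
    ∃ f : ι → β, ∀ i, R i f (f i) := by
  classical
  let step : (i : ι) → ((j : ι) → j < i → β) → β := fun i prev =>
    Classical.epsilon (R i (fun j => if h : j < i then prev j h else Classical.arbitrary β))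
  let f : ι → β := (wellFounded_lt (α := ι)).fix step
  refine ⟨f, fun i => ?_⟩
  induction i using WellFoundedLT.induction with
  | _ i ih =>
    obtain ⟨b, hb⟩ := hext i f ih
    have hf : f i = step i (fun j _ => f j) := (wellFounded_lt (α := ι)).fix_eq step i
    rw [hf]
    refine hcongr i (fun j => if j < i then f j else Classical.arbitrary β) f _
      (fun j hj => by simp [hj]) ?_
    exact Classical.epsilon_spec
      (p := R i (fun j => if j < i then f j else Classical.arbitrary β))
      ⟨b, hcongr i f _ b (fun j hj => by simp [hj]) hb⟩

/-! ### Self-maps preserving an ultrafilter -/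

/-- If no orbit of `f` stays in a finite subset of `A`, then there is a two-colouring in which
`x` and `f x` have different colours for all `x ∈ A`. -/
theorem exists_bool_coloring_of_escaping {α : Type*} (f : α → α) (A : Set α)
    (h : ∀ t : Finset α, (t : Set α) ⊆ A → ∀ x, ∃ k, f^[k] x ∉ t) :
    ∃ χ : α → Bool, ∀ x ∈ A, χ (f x) ≠ χ x := by
  classical
  have h' : ∀ (t : Finset α) (x : α), ∃ k, f^[k] x ∉ t.filter (· ∈ A) := fun t =>
    h _ (fun x hx => (Finset.mem_filter.1 hx).2)
  -- The colour is the parity of the exit time from `t ∩ A`, which drops by one under `f`; Rado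
  -- selection glues the colourings over all `t`.
  obtain ⟨χ, hχ⟩ := Finset.rado_selection (β := fun _ : α => Bool)
    (fun t x => (Nat.find (h' t x)).bodd)
  refine ⟨χ, fun x hx => ?_⟩
  obtain ⟨t, hst, ht⟩ := hχ {x, f x}
  rw [ht x (by simp), ht (f x) (by simp)]
  have hxt : x ∈ t := hst (by simp)
  rw [Nat.find_comp_succ (h' t x) (h' t (f x)) (by simp [hx, hxt])]
  simp

/-- An ultrafilter on a countable set that is mapped to itself by `f` contains the set of fixed
points of `f`. -/
theorem Ultrafilter.eventually_eq_of_map_eq {α : Type*} [Countable α] {u : Ultrafilter α}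
    {f : α → α} (h : u.map f = u) : ∀ᶠ x in (u : Filter α), f x = x := by
  have key : ∀ A : Set α, (∀ t : Finset α, (t : Set α) ⊆ A → ∀ x, ∃ k, f^[k] x ∉ t) →
      A ∉ u := by
    intro A hA hAu
    obtain ⟨χ, hχ⟩ := exists_bool_coloring_of_escaping f A hA
    have hb : ∀ b, χ ⁻¹' {b} ∉ u := fun b hb => by
      have hb' : f ⁻¹' (χ ⁻¹' {b}) ∈ u := by rw [← Ultrafilter.mem_map, h]; exact hb
      obtain ⟨x, ⟨hxA, hx⟩, hx'⟩ :=
        u.nonempty_of_mem (Filter.inter_mem (Filter.inter_mem hAu hb) hb')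
      simp only [Set.mem_preimage, Set.mem_singleton_iff] at hx hx'
      exact hχ x hxA (hx'.trans hx.symm)
    refine hb true (((u.mem_or_compl_mem _).resolve_right) fun hc => hb false ?_)
    convert hc using 1
    ext x; simp
  obtain ⟨enc, henc⟩ := exists_injective_nat α
  have horbit : ∀ (t : Finset α) (x : α), Function.Injective (fun k => f^[k] x) →
      ∃ k, f^[k] x ∉ t := by
    intro t x hinj
    by_contra! hk
    exact Set.infinite_of_injective_forall_mem hinj hk t.finite_toSet
  -- An orbit trapped here has strictly monotone codes, so it is infinite and cannot lie in a finite
  -- set.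
  have hlt : {x | enc (f x) < enc x} ∉ u := key _ fun t ht x => by
    by_contra! hk
    obtain ⟨k, hk'⟩ := horbit t x (Function.Injective.of_comp (f := enc)
      (strictAnti_nat_of_succ_lt fun k => by
        rw [Function.comp, Function.comp, Function.iterate_succ_apply']
        exact ht (hk k)).injective)
    exact hk' (hk k)
  have hgt : {x | enc x < enc (f x)} ∉ u := key _ fun t ht x => by
    by_contra! hk
    obtain ⟨k, hk'⟩ := horbit t x (Function.Injective.of_comp (f := enc)
      (strictMono_nat_of_lt_succ fun k => by
        rw [Function.comp, Function.comp, Function.iterate_succ_apply']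
        exact ht (hk k)).injective)
    exact hk' (hk k)
  filter_upwards [Ultrafilter.compl_mem_iff_notMem.2 hlt,
    Ultrafilter.compl_mem_iff_notMem.2 hgt] with x h1 h2
  exact henc (le_antisymm (not_lt.1 h2) (not_lt.1 h1))

/-! ### P-points avoiding a compactly graded ideal -/

/-- A family of fewer than `𝔟` functions `ℕ → ℕ` is eventually dominated by a single function. -/
theorem exists_eventually_le_of_mk_lt_boundingNumber {ι : Type} (f : ι → ℕ → ℕ)
    (h : Cardinal.mk ι < boundingNumber) :
    ∃ g : ℕ → ℕ, ∀ i, ∀ᶠ n in Filter.atTop, f i n ≤ g n := by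
  by_contra hg
  refine notMem_of_lt_csInf' (Cardinal.mk_range_le.trans_lt h) ⟨Set.range f, rfl, ?_⟩
  rintro ⟨g, hg'⟩
  exact hg ⟨g, fun i => hg' _ ⟨i, rfl⟩⟩

theorem IsPPoint.map {α β : Type} {u : Ultrafilter α} (hu : IsPPoint u) (f : α → β)
    (hfree : (u.map f : Filter β) ≤ Filter.cofinite) : IsPPoint (u.map f) := by
  refine ⟨hfree, fun V hV hcov => ?_⟩
  obtain ⟨U, hU, h⟩ := hu.2 (fun n => f ⁻¹' V n) (fun i j hij => (hV hij).preimage f)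
    (by rw [← Set.preimage_iUnion, hcov, Set.preimage_univ])
  refine ⟨f '' U, Filter.image_mem_map hU, h.imp ?_ fun h n => ?_⟩
  · rintro ⟨n, hn⟩
    exact ⟨n, Set.image_subset_iff.2 hn⟩
  · rw [← Set.image_inter_preimage]
    exact (h n).image f

/-- A graded notion of smallness on subsets of `α`, giving an ideal `{A | ∃ k, S k A}` whose every
grade `{A | S k A}` is compact. -/
structure IsCompactlyGraded {α : Type} (S : ℕ → Set α → Prop) : Prop where
  mono : ∀ {k l A B}, k ≤ l → A ⊆ B → S k B → S l A
  union : ∀ {k l A B}, S k A → S l B → ∃ m, S m (A ∪ B)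
  compact : ∀ {k A}, (∀ t : Finset α, (t : Set α) ⊆ A → S k t) → S k A
  not_univ : ∀ k, ¬ S k Set.univ
  singleton : ∀ x, ∃ k, S k {x}

namespace IsCompactlyGraded

variable {α : Type} {S : ℕ → Set α → Prop}

theorem small_union (hS : IsCompactlyGraded S) {A B : Set α} (hA : ∃ k, S k A)
    (hB : ∃ k, S k B) : ∃ k, S k (A ∪ B) :=
  let ⟨_, hk⟩ := hA
  let ⟨_, hl⟩ := hB
  hS.union hk hl

theorem small_mono (hS : IsCompactlyGraded S) {A B : Set α} (h : A ⊆ B) (hB : ∃ k, S k B) :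
    ∃ k, S k A :=
  hB.imp fun _ hk => hS.mono le_rfl h hk

theorem small_of_finite (hS : IsCompactlyGraded S) [Nonempty α] {A : Set α} (hA : A.Finite) :
    ∃ k, S k A := by
  induction A, hA using Set.Finite.induction_on with
  | empty => exact hS.small_mono (Set.empty_subset _) (hS.singleton (Classical.arbitrary α))
  | insert _ _ ih =>
    rw [Set.insert_eq]
    exact hS.small_union (hS.singleton _) ih

/-- A filter base of fewer than `𝔟` large sets can be extended, keeping all its members large, by a
set on which `v` is constant or finite-to-one. -/
theorem exists_selector [Countable α] (hS : IsCompactlyGraded S) {ι : Type} (F : ι → Set α)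
    (hι : Cardinal.mk ι < boundingNumber) (hdir : ∀ i j, ∃ l, F l ⊆ F i ∩ F j)
    (hF : ∀ i k, ¬ S k (F i)) (v : α → ℕ) :
    ∃ U : Set α, (∀ i k, ¬ S k (F i ∩ U)) ∧
      ((∃ n, U ⊆ v ⁻¹' {n}) ∨ ∀ n, (U ∩ v ⁻¹' {n}).Finite) := by
  by_cases hconst : ∃ n, ∀ i k, ¬ S k (F i ∩ v ⁻¹' {n})
  · obtain ⟨n, hn⟩ := hconst
    exact ⟨_, hn, Or.inl ⟨n, subset_rfl⟩⟩
  push Not at hconst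
  -- Discarding finitely many fibres, each small on some member of the base, keeps every member
  -- large.
  have htail : ∀ n i k, ¬ S k (F i ∩ {x | n ≤ v x}) := by
    intro n
    induction n with
    | zero => simpa using hF
    | succ n ih =>
      intro i k hk
      obtain ⟨j, hj⟩ := hconst n
      obtain ⟨l, hl⟩ := hdir i j
      obtain ⟨m, hm⟩ := hS.small_union ⟨k, hk⟩ hj
      refine ih l m (hS.mono le_rfl ?_ hm)
      rintro x ⟨hx, hxn⟩
      rcases (show n ≤ v x from hxn).eq_or_lt with h | h
      · exact Or.inr ⟨(hl hx).2, h.symm⟩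
      · exact Or.inl ⟨(hl hx).1, h⟩
  have hfin : ∀ i n, ∃ t : Finset α, (t : Set α) ⊆ F i ∩ {x | n ≤ v x} ∧ ¬ S n t := by
    intro i n
    by_contra! h
    exact htail n i n (hS.compact h)
  choose K hKsub hK using hfin
  obtain ⟨enc, henc⟩ := exists_injective_nat α
  -- Only the `K i n` with `n ≤ m` can contain points where `v = m`, so the supremum bounds the
  -- codes of all such points.
  obtain ⟨g, hg⟩ := exists_eventually_le_of_mk_lt_boundingNumber
    (fun i m => (Finset.range (m + 1)).sup fun n => (K i n).sup enc) hι
  refine ⟨{x | enc x ≤ g (v x)}, fun i k hk => ?_, Or.inr fun n => ?_⟩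
  · obtain ⟨N, hN⟩ := Filter.eventually_atTop.1 (hg i)
    -- Stage `max k N` is not `k`-small and lies where `v ≥ N`, hence where `g` dominates.
    refine hK i (max k N) (hS.mono (le_max_left k N) (fun x hx => ?_) hk)
    have hx' := hKsub i _ hx
    have hv : max k N ≤ v x := hx'.2
    refine ⟨hx'.1, le_trans ?_ (hN _ ((le_max_right k N).trans hv))⟩
    exact (Finset.le_sup (f := enc) hx).trans
      (Finset.le_sup (f := fun n => (K i n).sup enc) (Finset.mem_range.2 (by omega)))
  · refine ((Set.finite_Iic (g n)).preimage henc.injOn).subset ?_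
    rintro x ⟨hx, rfl⟩
    exact hx

end IsCompactlyGraded

/-- Bounds the number of finite intersections available at stage `i` of the recursion, so that
`exists_selector` applies. -/
theorem mk_setOf_finset_subset_Iio_lt (i : Cardinal.continuum.{0}.ord.ToType) :
    Cardinal.mk {s : Finset Cardinal.continuum.{0}.ord.ToType // ∀ j ∈ s, j < i} <
      Cardinal.continuum := by
  classical
  have hle : Cardinal.mk {s : Finset Cardinal.continuum.{0}.ord.ToType // ∀ j ∈ s, j < i} ≤
      Cardinal.mk (Finset (Set.Iio i)) := by
    refine Cardinal.mk_le_of_injective (f := fun s => s.1.subtype (· ∈ Set.Iio i)) ?_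
    rintro ⟨s, hs⟩ ⟨t, ht⟩ h
    rw [Subtype.mk.injEq, ← Finset.subtype_map_of_mem hs, ← Finset.subtype_map_of_mem ht]
    exact congrArg _ h
  refine hle.trans_lt ?_
  rcases finite_or_infinite (Set.Iio i) with h | h
  · exact (Cardinal.lt_aleph0_of_finite _).trans Cardinal.aleph0_lt_continuum
  · rw [Cardinal.mk_finset_of_infinite]
    simpa using Cardinal.mk_Iio_lt i (by simp)

namespace IsCompactlyGraded

variable {α : Type} {S : ℕ → Set α → Prop}

/-- If `𝔟 = 𝔠`, there is a centred family of sets, with large finite intersections, such that every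
function `α → ℕ` is constant or finite-to-one on some member. -/
theorem exists_selecting_family [Countable α] [Infinite α] (hS : IsCompactlyGraded S)
    (hbc : boundingNumber = Cardinal.continuum) :
    ∃ (ι : Type) (U : ι → Set α), (∀ (s : Finset ι) k, ¬ S k (⋂ i ∈ s, U i)) ∧
      ∀ v : α → ℕ, ∃ i, (∃ n, U i ⊆ v ⁻¹' {n}) ∨ ∀ n, (U i ∩ v ⁻¹' {n}).Finite := by
  classical
  let ι := Cardinal.continuum.{0}.ord.ToType
  have hcard : Cardinal.mk ι = Cardinal.mk (α → ℕ) := by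
    rw [Cardinal.mk_ord_toType]; simp
  obtain ⟨e⟩ := Cardinal.eq.1 hcard
  let R : ι → (ι → Set α) → Set α → Prop := fun i f V =>
    (∀ s : Finset ι, (∀ j ∈ s, j < i) → ∀ k, ¬ S k ((⋂ j ∈ s, f j) ∩ V)) ∧
      ((∃ n, V ⊆ e i ⁻¹' {n}) ∨ ∀ n, (V ∩ e i ⁻¹' {n}).Finite)
  have hlarge : ∀ (f : ι → Set α) (s : Finset ι), (∀ j ∈ s, R j f (f j)) →
      ∀ k, ¬ S k (⋂ j ∈ s, f j) := by
    intro f s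
    induction s using Finset.induction_on_max with
    | empty => intro _ k; simpa using hS.not_univ k
    | insert a s hs _ =>
      intro h k
      rw [Finset.set_biInter_insert, Set.inter_comm]
      exact (h a (Finset.mem_insert_self a s)).1 s hs k
  obtain ⟨U, hU⟩ := exists_forall_of_forall_exists_extension R
    (by
      rintro i f f' b h ⟨h1, h2⟩
      refine ⟨fun s hs k => ?_, h2⟩
      rw [← Set.iInter₂_congr fun j hj => h j (hs j hj)]
      exact h1 s hs k)
    (by
      intro i f hf
      obtain ⟨V, hV, hV'⟩ := hS.exists_selector
        (ι := {s : Finset ι // ∀ j ∈ s, j < i}) (fun s => ⋂ j ∈ s.1, f j)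
        ((mk_setOf_finset_subset_Iio_lt i).trans_eq hbc.symm)
        (fun s t => ⟨⟨s.1 ∪ t.1, fun j hj =>
          (Finset.mem_union.1 hj).elim (s.2 j) (t.2 j)⟩, Set.subset_inter
            (Set.biInter_subset_biInter_left fun _ => Finset.mem_union_left _)
            (Set.biInter_subset_biInter_left fun _ => Finset.mem_union_right _)⟩)
        (fun s => hlarge f s.1 fun j hj => hf j (s.2 j hj)) (e i)
      exact ⟨V, fun s hs => hV ⟨s, hs⟩, hV'⟩)
  refine ⟨ι, U, fun s => hlarge U s fun j _ => hU j, fun v => ⟨e.symm v, ?_⟩⟩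
  simpa using (hU (e.symm v)).2

/-- If `𝔟 = 𝔠`, there is a P-point all of whose members are large. -/
theorem exists_isPPoint [Countable α] [Infinite α] (hS : IsCompactlyGraded S)
    (hbc : boundingNumber = Cardinal.continuum) :
    ∃ u : Ultrafilter α, IsPPoint u ∧ ∀ A ∈ u, ∀ k, ¬ S k A := by
  classical
  obtain ⟨ι, U, hU, hsel⟩ := hS.exists_selecting_family hbc
  -- Complements of small sets belong to `L`, so no ultrafilter above it has a small member.
  let L : Filter α :=
    { sets := {A | ∃ s : Finset ι, ∃ k, S k ((⋂ i ∈ s, U i) \ A)}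
      univ_sets := ⟨∅, hS.small_of_finite (by simp)⟩
      sets_of_superset := fun ⟨s, hs⟩ hAB =>
        ⟨s, hS.small_mono (Set.sdiff_subset_sdiff_right hAB) hs⟩
      inter_sets := fun ⟨s, hs⟩ ⟨t, ht⟩ => ⟨s ∪ t, hS.small_mono (by
        rw [Set.sdiff_inter]
        exact Set.union_subset_union
          (Set.sdiff_subset_sdiff_left
            (Set.biInter_subset_biInter_left fun _ => Finset.mem_union_left _))
          (Set.sdiff_subset_sdiff_left
            (Set.biInter_subset_biInter_left fun _ => Finset.mem_union_right _))) (hS.small_union hs ht)⟩ }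
  have hne : L.NeBot := by
    refine ⟨fun h => ?_⟩
    obtain ⟨s, k, hk⟩ : ∅ ∈ L := h ▸ Filter.mem_bot
    exact hU s k (by simpa using hk)
  have hle := Ultrafilter.of_le L
  have hsmall : ∀ A ∈ Ultrafilter.of L, ∀ k, ¬ S k A := fun A hA k hk =>
    Ultrafilter.compl_notMem_iff.2 hA (hle ⟨∅, k, by simpa using hk⟩)
  refine ⟨Ultrafilter.of L, ⟨fun A hA => ?_, fun V hV hcov => ?_⟩, hsmall⟩
  · by_contra hA'
    obtain ⟨k, hk⟩ := hS.small_of_finite (Filter.mem_cofinite.1 hA)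
    exact hsmall _ (Ultrafilter.compl_mem_iff_notMem.2 hA') k hk
  · choose v hv using fun x => Set.mem_iUnion.1 (hcov ▸ Set.mem_univ x : x ∈ ⋃ n, V n)
    have hpre : ∀ n, v ⁻¹' {n} = V n := fun n => by
      ext x
      refine ⟨fun h => (show v x = n from h) ▸ hv x, fun h => ?_⟩
      by_contra hne
      exact Set.disjoint_left.1 (hV hne) (hv x) h
    obtain ⟨i, hi⟩ := hsel v
    simp only [hpre] at hi
    exact ⟨U i, hle ⟨{i}, hS.small_of_finite (by simp)⟩, hi⟩

end IsCompactlyGraded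

/-! ### The ideal of predictable sets -/

theorem truncBelow_apply (ξ : ℝ) (x : ℚ →₀ ℕ) (r : ℚ) [Decidable ((r : ℝ) < ξ)] :
    truncBelow ξ x r = if (r : ℝ) < ξ then x r else 0 := by
  classical
  rw [truncBelow, Finsupp.filter_apply]
  congr

theorem truncBelow_truncBelow {ξ η : ℝ} (h : ξ ≤ η) (x : ℚ →₀ ℕ) :
    truncBelow ξ (truncBelow η x) = truncBelow ξ x := by
  classical
  ext r
  simp only [truncBelow_apply]
  split_ifs with h1 h2
  · rfl
  · exact absurd (h1.trans_le h) h2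
  · rfl

theorem truncBelow_update_of_le {ξ : ℝ} {a : ℚ} (h : ξ ≤ a) (x : ℚ →₀ ℕ) (n : ℕ) :
    truncBelow ξ (x.update a n) = truncBelow ξ x := by
  classical
  ext r
  simp only [truncBelow_apply, Finsupp.update_apply]
  split_ifs with h1 h2
  · subst h2
    exact absurd h1 h.not_gt
  · rfl
  · rfl

/-- Finitely many predictions of single coordinates from the coordinates below them can all be
evaded. -/
theorem exists_forall_apply_ne {ι : Type*} [Finite ι] (p : ι → ℚ) (g : ι → (ℚ →₀ ℕ) → ℕ) :
    ∃ x : ℚ →₀ ℕ, ∀ i, x (p i) ≠ g i (truncBelow (p i) x) := by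
  classical
  cases nonempty_fintype ι
  suffices h : ∀ T : Finset ℚ, ∃ x : ℚ →₀ ℕ, ∀ i, p i ∈ T →
      x (p i) ≠ g i (truncBelow (p i) x) by
    obtain ⟨x, hx⟩ := h (Finset.univ.image p)
    exact ⟨x, fun i => hx i (by simp)⟩
  intro T
  induction T using Finset.induction_on_max with
  | empty => exact ⟨0, by simp⟩
  | insert a T hT ih =>
    obtain ⟨x, hx⟩ := ih
    -- The new value exceeds every prediction at `a`; as `a` is above `T`, nothing at or below
    -- points of `T` changes.
    refine ⟨x.update a (∑ i, g i (truncBelow a x) + 1), fun i hi => ?_⟩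
    rcases Finset.mem_insert.1 hi with h | h
    · rw [h, truncBelow_update_of_le le_rfl, Finsupp.update_apply, if_pos rfl]
      have := Finset.single_le_sum (f := fun i => g i (truncBelow a x))
        (fun _ _ => Nat.zero_le _) (Finset.mem_univ i)
      omega
    · have hlt := hT _ h
      rw [truncBelow_update_of_le (by exact_mod_cast hlt.le), Finsupp.update_apply,
        if_neg hlt.ne]
      exact hx i h

/-- With `π` an enumeration of `ℚ`: `A` can be divided into pieces coloured by pairs `(n, j)` with
`n, j < k`, such that on a piece of colour `(n, j)` the coordinate at `π n` is determined by the
coordinates below `π n`. -/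
def PredictablyColorable (π : ℕ → ℚ) (k : ℕ) (A : Set (ℚ →₀ ℕ)) : Prop :=
  ∃ c : (ℚ →₀ ℕ) → Fin k × Fin k, ∀ x ∈ A, ∀ y ∈ A, c x = c y →
    truncBelow (π (c x).1) x = truncBelow (π (c x).1) y → x (π (c x).1) = y (π (c x).1)

theorem predictablyColorable_of_subset (π : ℕ → ℚ) (n : ℕ) (g : (ℚ →₀ ℕ) → ℕ)
    {A : Set (ℚ →₀ ℕ)} (h : ∀ x ∈ A, x (π n) = g (truncBelow (π n) x)) :
    PredictablyColorable π (n + 1) A := by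
  refine ⟨fun _ => (Fin.last n, 0), fun x hx y hy _ hxy => ?_⟩
  simp only [Fin.val_last] at hxy ⊢
  rw [h x hx, h y hy, hxy]

theorem isCompactlyGraded_predictablyColorable (π : ℕ → ℚ) :
    IsCompactlyGraded (PredictablyColorable π) := by
  classical
  constructor
  · rintro k l A B hkl hAB ⟨c, hc⟩
    refine ⟨fun x => ((c x).1.castLE hkl, (c x).2.castLE hkl), fun x hx y hy hxy => ?_⟩
    exact hc x (hAB hx) y (hAB hy) (by simpa [Prod.ext_iff] using hxy)
  · rintro k l A B ⟨c, hc⟩ ⟨d, hd⟩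
    -- The second component is below `k` exactly on `A`, so the two palettes never clash.
    refine ⟨k + l, fun x => if x ∈ A then ((c x).1.castAdd l, (c x).2.castAdd l)
      else (⟨(d x).1, by omega⟩, (d x).2.natAdd k), fun x hx y hy => ?_⟩
    by_cases hxA : x ∈ A <;> by_cases hyA : y ∈ A <;> simp only [hxA, hyA, if_true, if_false]
    · intro hxy
      exact hc x hxA y hyA (by simpa [Prod.ext_iff] using hxy)
    · intro hxy
      have := congrArg (fun z => (z.2 : ℕ)) hxy
      simp at this
      omega
    · intro hxy
      have := congrArg (fun z => (z.2 : ℕ)) hxy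
      simp at this
      omega
    · intro hxy
      refine hd x (hx.resolve_left hxA) y (hy.resolve_left hyA) ?_
      simp only [Prod.mk.injEq, Fin.mk.injEq, Fin.natAdd_inj] at hxy
      exact Prod.ext (Fin.ext hxy.1) hxy.2
  · intro k A h
    have h' : ∀ t : Finset (ℚ →₀ ℕ), PredictablyColorable π k (t.filter (· ∈ A) : Finset _) :=
      fun t => h _ fun x hx => (Finset.mem_filter.1 hx).2
    choose c hc using h'
    -- Each grade uses a finite palette, which gives compactness.
    obtain ⟨χ, hχ⟩ := Finset.rado_selection (β := fun _ => Fin k × Fin k) c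
    refine ⟨χ, fun x hx y hy => ?_⟩
    obtain ⟨t, hst, ht⟩ := hχ {x, y}
    rw [ht x (by simp), ht y (by simp)]
    exact hc t x (by simpa [hx] using hst (by simp)) y (by simpa [hy] using hst (by simp))
  · rintro k ⟨c, hc⟩
    have hg : ∀ i : Fin k × Fin k, ∃ g : (ℚ →₀ ℕ) → ℕ, ∀ x, c x = i →
        x (π i.1) = g (truncBelow (π i.1) x) := by
      intro i
      refine ⟨fun z => if h : ∃ y, c y = i ∧ truncBelow (π i.1) y = z then h.choose (π i.1) else 0,
        fun x hx => ?_⟩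
      have h : ∃ y, c y = i ∧ truncBelow (π i.1) y = truncBelow (π i.1) x := ⟨x, hx, rfl⟩
      simp only [dif_pos h]
      have h1 := h.choose_spec
      subst hx
      exact hc x trivial _ trivial h1.1.symm h1.2.symm
    choose g hg using hg
    obtain ⟨x, hx⟩ := exists_forall_apply_ne (fun i : Fin k × Fin k => π i.1) g
    exact hx (c x) (hg (c x) x rfl)
  · intro x
    exact ⟨_, predictablyColorable_of_subset π 0 (fun _ => x (π 0)) (by simp)⟩

/-! ### Order embeddings and the main theorem -/

/-- The order embedding of a linear order into the P-points given by a family of P-points that is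
monotone and reflects the order. -/
theorem exists_orderEmbedding_of_rkle_iff {α : Type} {ι : Type*} [LinearOrder ι]
    (u : ι → Ultrafilter α) (hu : ∀ i, IsPPoint (u i))
    (h : ∀ i j, RKLE (u i : Filter α) (u j : Filter α) ↔ i ≤ j) :
    ∃ Φ : ι ↪o PPoint α, ∀ i, (Φ i).toUltrafilter = u i :=
  ⟨{ toFun := fun i => ⟨u i, hu i⟩
     inj' := fun i j hij => by
      have hij' : u i = u j := congrArg PPoint.toUltrafilter hij
      exact le_antisymm ((h i j).1 (hij' ▸ ⟨id, fun _ hS => hS⟩))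
        ((h j i).1 (hij' ▸ ⟨id, fun _ hS => hS⟩))
     map_rel_iff' := h _ _ }, fun _ => rfl⟩

theorem rkle_map_equiv_iff {α β : Type} (e : α ≃ β) (u v : Ultrafilter α) :
    RKLE (u.map e : Filter β) (v.map e : Filter β) ↔ RKLE (u : Filter α) (v : Filter α) := by
  constructor
  · rintro ⟨h, hh⟩
    refine ⟨e.symm ∘ h ∘ e, fun A hA => ?_⟩
    refine hh (e.symm ⁻¹' A) ?_
    rw [Ultrafilter.mem_coe, Ultrafilter.mem_map, ← Set.preimage_comp]
    simpa using hA
  · rintro ⟨h, hh⟩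
    refine ⟨e ∘ h ∘ e.symm, fun A hA => ?_⟩
    have := hh _ hA
    rw [Ultrafilter.mem_coe, Ultrafilter.mem_map, ← Set.preimage_comp]
    rwa [show (e ∘ h ∘ e.symm) ∘ e = e ∘ h from funext fun x => by simp, Set.preimage_comp]

theorem mainTheorem4 (hbc : boundingNumber = Cardinal.continuum) :
    ∃ D : PPoint (ℚ →₀ ℕ),
      (∃ Φ : ℝ ↪o PPoint (ℚ →₀ ℕ), ∀ ξ : ℝ,
        (Φ ξ).toUltrafilter = D.toUltrafilter.map (truncBelow ξ)) ∧
      ∃ (e : (ℚ →₀ ℕ) ≃ ℕ) (Ψ : ℝ ↪o PPoint ℕ), ∀ ξ : ℝ,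
        (Ψ ξ).toUltrafilter = (D.toUltrafilter.map (truncBelow ξ)).map e := by
  obtain ⟨π, hπ⟩ := exists_surjective_nat ℚ
  obtain ⟨D, hD, hlarge⟩ := (isCompactlyGraded_predictablyColorable π).exists_isPPoint hbc
  have hpred : ∀ (p : ℚ) (g : (ℚ →₀ ℕ) → ℕ), {x | x p = g (truncBelow p x)} ∉ D := by
    intro p g hmem
    obtain ⟨n, rfl⟩ := hπ p
    exact hlarge _ hmem _ (predictablyColorable_of_subset π n g fun x hx => hx)
  have hP : ∀ ξ, IsPPoint (D.map (truncBelow ξ)) := by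
    intro ξ
    -- If the image were principal, a coordinate below `ξ` would be constant on a member of `D`.
    refine hD.map _ ((Ultrafilter.le_cofinite_or_eq_pure _).resolve_right ?_)
    rintro ⟨a, ha⟩
    obtain ⟨p, hp⟩ := exists_rat_lt ξ
    have hmem : truncBelow ξ ⁻¹' {a} ∈ D := by
      rw [← Ultrafilter.mem_map, ha]; exact Set.mem_singleton a
    refine hpred p (fun _ => a p) (Filter.mem_of_superset hmem fun x hx => ?_)
    classical
    have hx' := DFunLike.congr_fun (show truncBelow ξ x = a from hx) p
    rwa [truncBelow_apply, if_pos hp] at hx'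
  have hRK : ∀ ξ η, RKLE (D.map (truncBelow ξ) : Filter (ℚ →₀ ℕ))
      (D.map (truncBelow η) : Filter (ℚ →₀ ℕ)) ↔ ξ ≤ η := by
    intro ξ η
    constructor
    · rintro ⟨g, hg⟩
      by_contra! hlt
      obtain ⟨p, hp1, hp2⟩ := exists_rat_btwn hlt
      have hcomp : truncBelow η ∘ truncBelow ξ = truncBelow η :=
        funext (truncBelow_truncBelow hlt.le)
      have hfix : (D.map (truncBelow ξ)).map (g ∘ truncBelow η) = D.map (truncBelow ξ) := by
        rw [← Ultrafilter.map_map, Ultrafilter.map_map D, hcomp]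
        exact Ultrafilter.eq_of_le hg
      have hev := Ultrafilter.eventually_eq_of_map_eq hfix
      refine hpred p (fun z => g (truncBelow η z) p) (Filter.mem_of_superset hev fun x hx => ?_)
      classical
      have hx' := DFunLike.congr_fun
        (show g (truncBelow η (truncBelow ξ x)) = truncBelow ξ x from hx) p
      rw [truncBelow_truncBelow hlt.le, truncBelow_apply, if_pos hp2] at hx'
      show x p = g (truncBelow η (truncBelow p x)) p
      rw [truncBelow_truncBelow hp1.le, hx']
    · intro h
      refine ⟨truncBelow ξ, fun A hA => ?_⟩
      rw [Ultrafilter.mem_coe, Ultrafilter.mem_map] at hA ⊢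
      rw [← Set.preimage_comp, show truncBelow ξ ∘ truncBelow η = truncBelow ξ from
        funext (truncBelow_truncBelow h)]
      exact hA
  obtain ⟨e⟩ := nonempty_equiv_of_countable (α := ℚ →₀ ℕ) (β := ℕ)
  refine ⟨⟨D, hD⟩, exists_orderEmbedding_of_rkle_iff _ hP hRK, e, ?_⟩
  refine exists_orderEmbedding_of_rkle_iff _ (fun ξ => (hP ξ).map e ?_)
    fun ξ η => (rkle_map_equiv_iff e _ _).trans (hRK ξ η)
  exact (Filter.map_mono (hP ξ).1).trans e.injective.tendsto_cofinite
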